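/- Let $H$ and $P$ be natural numbers with $H\neq P$. On a probability space, let $\mathbf z=(z_1,\dots,z_H)$ be a vector of $H$ independent standard Gaussian random variables and let $\mathbf y=(y_1,\dots,y_P)$ be a vector of $P$ independent standard Gaussian random variables (no assumption is made on the joint distribution of $\mathbf z$ and $\mathbf y$). Then $\mathbf z$ and $\mathbf y$ cannot be generating factors of each other: there are no continuous functions $f:\mathbb R^H\to\mathbb R^P$ and $g:\mathbb R^P\to\mathbb R^H$ such that $$\mathbf z=g(\mathbf y)\quad\text{and}\quad \mathbf y=f(\mathbf z)\qquad\text{almost surely.}$$ -/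

import Mathlib

open MeasureTheory ProbabilityTheory

/-! The Gaussian law has full support, so `g ∘ f` and `f ∘ g`, being continuous and almost surely
the identity, are identities everywhere. It remains to see that the larger space cannot embed in the
smaller with a continuous left inverse. A `C¹` approximation of the left inverse misses points near
`0`; translating by one and smoothing gives a nowhere zero `C¹` map close to the identity, hence a
`C¹` retraction `r` onto the sphere. The Milnor–Rogers volume argument excludes it: with `w = r -
id`, the integral of `det (1 + t • w')` over the ball is polynomial in `t`, equals the volume for
small `t ≥ 0`, yet vanishes at `t = 1`. -/

open Metric in
theorem LipschitzOnWith.indicator_closedBall {E F : Type*} [NormedAddCommGroup E] [NormedSpace ℝ E]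
    [NormedAddCommGroup F] {K : NNReal} {u : E → F} {R : ℝ}
    (hu : LipschitzOnWith K u (closedBall 0 R)) (h0 : ∀ x, ‖x‖ = R → u x = 0) :
    LipschitzWith K ((closedBall 0 R).indicator u) := by
  have key : ∀ x y : E, ‖x‖ ≤ R → R < ‖y‖ → dist (u x) 0 ≤ K * dist x y := by
    intro x y hx hy
    have hc : ContinuousOn (fun t : ℝ => ‖AffineMap.lineMap x y t‖) (Set.Icc (0 : ℝ) 1) :=
      (AffineMap.lineMap_continuous.norm).continuousOn
    -- The segment from `x` to `y` meets the sphere, where `u` vanishes, no farther from `x` than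
    -- `y` is.
    obtain ⟨t, ht, htR⟩ := intermediate_value_Icc zero_le_one hc
      (show R ∈ Set.Icc _ _ by simpa using ⟨hx, hy.le⟩)
    have htR' : ‖AffineMap.lineMap x y t‖ = R := htR
    rw [← h0 _ htR']
    refine (hu.dist_le_mul x (by simpa using hx) _ (by simpa using htR'.le)).trans ?_
    refine mul_le_mul_of_nonneg_left ?_ K.coe_nonneg
    rw [dist_left_lineMap, Real.norm_of_nonneg ht.1]
    exact mul_le_of_le_one_left dist_nonneg ht.2
  refine LipschitzWith.of_dist_le_mul fun x y => ?_
  by_cases hx : x ∈ closedBall (0 : E) R <;> by_cases hy : y ∈ closedBall (0 : E) R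
  · simpa [Set.indicator, hx, hy] using hu.dist_le_mul x hx y hy
  · simp only [Set.indicator, hx, hy, if_true, if_false]
    exact key x y (by simpa using hx) (by simpa using hy)
  · simp only [Set.indicator, hx, hy, if_true, if_false]
    rw [dist_comm, dist_comm x y]
    exact key y x (by simpa using hy) (by simpa using hx)
  · simp only [Set.indicator, hx, hy, if_false, dist_self]
    positivity

theorem LinearMap.exists_polynomial_eval_eq_det_one_add_smul {E : Type*} [AddCommGroup E]
    [Module ℝ E] [FiniteDimensional ℝ E] (A : E →ₗ[ℝ] E) :
    ∃ p : Polynomial ℝ, p.natDegree ≤ Module.finrank ℝ E ∧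
      ∀ t : ℝ, p.eval t = LinearMap.det (1 + t • A) := by
  let b := Module.finBasis ℝ E
  let M := LinearMap.toMatrix b b A
  refine ⟨((Polynomial.X : Polynomial ℝ) • M.map Polynomial.C +
    (1 : Matrix (Fin (Module.finrank ℝ E)) (Fin (Module.finrank ℝ E)) ℝ).map Polynomial.C).det,
    by simpa using Polynomial.natDegree_det_X_add_C_le M 1, fun t => ?_⟩
  rw [← LinearMap.det_toMatrix b, ← Polynomial.coe_evalRingHom, RingHom.map_det]
  congr 1
  ext i j
  rw [map_add (LinearMap.toMatrix b b), map_smul, LinearMap.toMatrix_one]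
  by_cases hij : i = j
  · simp [M, hij, add_comm, mul_comm t]
  · simp [M, hij, mul_comm t]

theorem hasFDerivAt_one_add_smul {E : Type*} [NormedAddCommGroup E] [NormedSpace ℝ E]
    {w : E → E} {w' : E →L[ℝ] E} {x : E} (h : HasFDerivAt w w' x) (t : ℝ) :
    HasFDerivAt (fun x => x + t • w x) (1 + t • w') x :=
  (hasFDerivAt_id x).add (h.const_smul t)

open Metric in
/-- The total Jacobian of a small Lipschitz perturbation of the identity supported in a set
equals the measure of that set. -/
theorem setIntegral_abs_det_one_add_smul {E : Type*} [NormedAddCommGroup E]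
    [NormedSpace ℝ E] [FiniteDimensional ℝ E] [MeasurableSpace E] [BorelSpace E]
    (μ : Measure E) [μ.IsAddHaarMeasure] {K : NNReal} {w : E → E} {w' : E → E →L[ℝ] E} {s : Set E}
    (hs : MeasurableSet s) (hw : LipschitzWith K w) (hd : ∀ x ∈ s, HasFDerivAt w (w' x) x)
    (h0 : ∀ x ∉ s, w x = 0) {t : ℝ} (ht : 0 ≤ t) (htK : t * K < 1) :
    ∫ x in s, |(1 + t • w' x).det| ∂μ = μ.real s := by
  have hL : LipschitzWith (t.toNNReal * K) (fun x => t • w x) := by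
    refine LipschitzWith.of_dist_le_mul fun x y => ?_
    rw [dist_smul₀, Real.norm_of_nonneg ht, NNReal.coe_mul, Real.coe_toNNReal _ ht, mul_assoc]
    exact mul_le_mul_of_nonneg_left (hw.dist_le_mul x y) ht
  have hA : ApproximatesLinearOn (fun x => x + t • w x)
      ((ContinuousLinearEquiv.refl ℝ E : E ≃L[ℝ] E) : E →L[ℝ] E) Set.univ (t.toNNReal * K) := by
    rw [ApproximatesLinearOn.approximatesLinearOn_iff_lipschitzOnWith, lipschitzOnWith_univ]
    convert hL using 1
    ext x; simp
  have hlt : t.toNNReal * K < 1 := by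
    rw [← NNReal.coe_lt_coe]; simpa [Real.coe_toNNReal _ ht] using htK
  have hc : Subsingleton E ∨ t.toNNReal * K <
      ‖((ContinuousLinearEquiv.refl ℝ E).symm : E →L[ℝ] E)‖₊⁻¹ := by
    rcases subsingleton_or_nontrivial E with h | h
    · exact .inl h
    · refine .inr ?_
      have : ‖((ContinuousLinearEquiv.refl ℝ E).symm : E →L[ℝ] E)‖₊ = 1 := by
        exact ContinuousLinearMap.nnnorm_id
      rw [this]; simpa using hlt
  have hbij : Function.Bijective (fun x => x + t • w x) := ⟨Set.injOn_univ.1 (hA.injOn hc), hA.surjective hc⟩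
  -- The bijection is the identity off `s`, so it maps `s` onto itself.
  have him : (fun x => x + t • w x) '' s = s := by
    have : (fun x => x + t • w x) '' sᶜ = sᶜ := by
      conv_rhs => rw [← Set.image_id sᶜ]
      exact Set.image_congr fun x hx => by simp [h0 x hx]
    rwa [Set.image_compl_eq hbij, compl_inj_iff] at this
  have := integral_image_eq_integral_abs_det_fderiv_smul μ hs
    (fun x hx => (hasFDerivAt_one_add_smul (hd x hx) t).hasFDerivWithinAt)
    hbij.1.injOn (fun _ => (1 : ℝ))
  rw [him] at this
  simpa using this.symm

theorem exists_pos_forall_norm_le_det_one_add_smul_pos {E : Type*} [NormedAddCommGroup E]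
    [NormedSpace ℝ E] [FiniteDimensional ℝ E] (C : ℝ) :
    ∃ δ > 0, ∀ A : E →L[ℝ] E, ‖A‖ ≤ C → ∀ t : ℝ, 0 ≤ t → t ≤ δ → 0 < (1 + t • A).det := by
  have hev : ∀ᶠ B : E →L[ℝ] E in nhds 1, 0 < B.det := by
    have h1 : (1 : E →L[ℝ] E).det = 1 := LinearMap.det_id
    exact continuousAt_const.eventually_lt ContinuousLinearMap.continuous_det.continuousAt
      (by rw [h1]; exact one_pos)
  obtain ⟨ε, hε, h⟩ := Metric.eventually_nhds_iff.1 hev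
  refine ⟨ε / 2 / (|C| + 1), by positivity, fun A hA t ht htδ => h ?_⟩
  rw [dist_eq_norm, add_sub_cancel_left, norm_smul, Real.norm_of_nonneg ht]
  calc t * ‖A‖ ≤ ε / 2 / (|C| + 1) * (|C| + 1) := by
        gcongr
        linarith [le_abs_self C]
    _ = ε / 2 := by field_simp
    _ < ε := by linarith

/-- The integral of a determinant `det (1 + t • A x)` is polynomial in `t`; if it is constant for
small `t ≥ 0` then it keeps that value at `t = 1`. -/
theorem setIntegral_det_one_add_eq {E : Type*} [NormedAddCommGroup E]
    [NormedSpace ℝ E] [FiniteDimensional ℝ E] {X : Type*} [MeasurableSpace X]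
    {μ : Measure X} {A : X → E →L[ℝ] E} {δ c : ℝ} (hδ : 0 < δ)
    (hint : ∀ t : ℝ, Integrable (fun x => (1 + t • A x).det) μ)
    (h : ∀ t : ℝ, 0 ≤ t → t ≤ δ → ∫ x, (1 + t • A x).det ∂μ = c) :
    ∫ x, (1 + A x).det ∂μ = c := by
  let n := Module.finrank ℝ E
  let s := Finset.range (n + 1)
  -- These `n + 1` distinct nodes in `[0, δ]` determine a polynomial of degree at most `n`.
  let v : ℕ → ℝ := fun i => δ * i / (n + 1)
  have hv : Set.InjOn v s := by
    intro i _ j _ hij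
    have hn : (n + 1 : ℝ) ≠ 0 := by positivity
    exact_mod_cast mul_left_cancel₀ hδ.ne' ((div_left_inj' hn).1 hij)
  have hv0 : ∀ i ∈ s, 0 ≤ v i ∧ v i ≤ δ := by
    intro i hi
    have hi' : (i : ℝ) ≤ n + 1 := by
      have := Finset.mem_range.1 hi
      exact_mod_cast this.le
    refine ⟨by positivity, ?_⟩
    rw [div_le_iff₀ (by positivity)]
    gcongr
  have hpoly : ∀ B : E →L[ℝ] E, (1 + B).det =
      ∑ i ∈ s, (1 + v i • B).det * (Lagrange.basis s v i).eval 1 := by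
    intro B
    obtain ⟨p, hp, hpe⟩ :=
      LinearMap.exists_polynomial_eval_eq_det_one_add_smul (B : E →ₗ[ℝ] E)
    have hdeg : p.degree < s.card := by
      rw [Finset.card_range]
      exact (Polynomial.degree_le_of_natDegree_le hp).trans_lt
        (by exact_mod_cast Nat.lt_succ_self _)
    have h1 := congrArg (Polynomial.eval 1) (Lagrange.eq_interpolate hv hdeg)
    simp only [Lagrange.interpolate_apply, Polynomial.eval_finsetSum, Polynomial.eval_mul,
      Polynomial.eval_C, hpe, one_smul] at h1
    exact h1
  have hbasis : ∑ i ∈ s, (Lagrange.basis s v i).eval 1 = 1 := by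
    rw [← Polynomial.eval_finsetSum, Lagrange.sum_basis hv ⟨0, by simp [s]⟩, Polynomial.eval_one]
  rw [integral_congr_ae (Filter.Eventually.of_forall fun x => hpoly (A x)),
    integral_finsetSum _ fun i _ => (hint (v i)).mul_const _]
  simp_rw [integral_mul_const]
  rw [Finset.sum_congr rfl fun i hi => by rw [h (v i) (hv0 i hi).1 (hv0 i hi).2],
    ← Finset.mul_sum, hbasis, mul_one]

open Metric in
/-- A `C¹` map with values in the unit sphere cannot fix the unit sphere pointwise. -/
theorem ContDiff.not_forall_norm_eq_one_and_fixes_sphere {E : Type*} [NormedAddCommGroup E]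
    [InnerProductSpace ℝ E] [FiniteDimensional ℝ E] {r : E → E} (hr : ContDiff ℝ 1 r)
    (hnorm : ∀ x, ‖r x‖ = 1) (hfix : ∀ x, ‖x‖ = 1 → r x = x) : False := by
  borelize E
  let μ : Measure E := Measure.addHaar
  let w' : E → E →L[ℝ] E := fun x => fderiv ℝ r x - 1
  have hrd : ∀ x, HasFDerivAt r (fderiv ℝ r x) x := fun x =>
    (hr.differentiable one_ne_zero x).hasFDerivAt
  have hw'c : Continuous w' := (hr.continuous_fderiv one_ne_zero).sub continuous_const
  have hdet : ∀ x, (fderiv ℝ r x).det = 0 := by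
    intro x
    -- Since `‖r‖ ^ 2` is constant, the derivative takes values orthogonal to `r x ≠ 0` and is not
    -- onto.
    have hinner : ∀ v, Inner.inner ℝ (r x) (fderiv ℝ r x v) = 0 := by
      intro v
      have h1 : HasFDerivAt (fun y => ‖r y‖ ^ 2) _ x := (hrd x).norm_sq
      have h2 : HasFDerivAt (fun y => ‖r y‖ ^ 2) (0 : E →L[ℝ] ℝ) x := by
        simpa [hnorm] using hasFDerivAt_const (1 : ℝ) x
      simpa using congrArg (fun L : E →L[ℝ] ℝ => L v) (h1.unique h2)
    by_contra hne
    have hsurj : Function.Surjective (fderiv ℝ r x : E →ₗ[ℝ] E) :=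
      ((LinearMap.isUnit_iff_isUnit_det _).2 (isUnit_iff_ne_zero.2 hne)
        |> (Module.End.isUnit_iff _).1).2
    obtain ⟨v, hv⟩ := hsurj (r x)
    have h1 := hinner v
    rw [show fderiv ℝ r x v = r x from hv, real_inner_self_eq_norm_sq, hnorm] at h1
    norm_num at h1
  obtain ⟨K, hK⟩ : ∃ K, LipschitzOnWith K (fun x => r x - x) (closedBall 0 1) :=
    LocallyLipschitzOn.exists_lipschitzOnWith_of_compact (isCompact_closedBall 0 1)
      ((hr.sub contDiff_id).locallyLipschitz.locallyLipschitzOn)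
  have hw := hK.indicator_closedBall fun x hx => by simp [hfix x hx]
  obtain ⟨C, hC⟩ := (isCompact_closedBall (0 : E) 1).exists_bound_of_continuousOn hw'c.continuousOn
  obtain ⟨δ, hδ, hpos⟩ := exists_pos_forall_norm_le_det_one_add_smul_pos (E := E) C
  have hd : ∀ x ∈ ball (0 : E) 1,
      HasFDerivAt ((closedBall 0 1).indicator fun x => r x - x) (w' x) x := by
    intro x hx
    refine ((hrd x).sub (hasFDerivAt_id x)).congr_of_eventuallyEq ?_
    filter_upwards [isOpen_ball.mem_nhds hx] with y hy
    exact Set.indicator_of_mem (ball_subset_closedBall hy) _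
  have h0 : ∀ x ∉ ball (0 : E) 1, (closedBall 0 1).indicator (fun x => r x - x) x = 0 := by
    intro x hx
    by_cases hx' : x ∈ closedBall (0 : E) 1
    · rw [Set.indicator_of_mem hx', hfix x, sub_self]
      exact le_antisymm (by simpa using hx') (by simpa using hx)
    · exact Set.indicator_of_notMem hx' _
  have hint : ∀ t : ℝ, Integrable (fun x => (1 + t • w' x).det) (μ.restrict (ball 0 1)) := by
    intro t
    have : Continuous fun x => (1 + t • w' x).det :=
      ContinuousLinearMap.continuous_det.comp (continuous_const.add (hw'c.const_smul t))
    exact (this.continuousOn.integrableOn_compact (isCompact_closedBall 0 1)).mono_set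
      ball_subset_closedBall
  -- The bound `δ` keeps the determinant positive; `1 / (K + 1)` makes the perturbation contracting.
  have hmain := setIntegral_det_one_add_eq (μ := μ.restrict (ball 0 1)) (A := w')
    (δ := min δ (1 / (K + 1))) (c := μ.real (ball 0 1)) (by positivity) hint fun t ht htδ => by
      have htK : t * K < 1 := by
        have h1 : t ≤ 1 / (K + 1) := htδ.trans (min_le_right _ _)
        rw [le_div_iff₀ (by positivity)] at h1
        rcases ht.eq_or_lt with rfl | ht'
        · simp
        · linarith
      rw [← setIntegral_abs_det_one_add_smul μ measurableSet_ball hw hd h0 ht htK]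
      refine setIntegral_congr_fun measurableSet_ball fun x hx => ?_
      exact (abs_of_pos (hpos _ (hC x (ball_subset_closedBall hx)) t ht
        (htδ.trans (min_le_left _ _)))).symm
  simp only [w', add_sub_cancel, hdet, integral_zero] at hmain
  have : 0 < μ.real (ball (0 : E) 1) :=
    ENNReal.toReal_pos (measure_ball_pos μ 0 one_pos).ne' measure_ball_lt_top.ne
  linarith

/-- A nowhere vanishing `C¹` map cannot be uniformly close to the identity. -/
theorem ContDiff.exists_eq_zero_of_norm_sub_lt {E : Type*} [NormedAddCommGroup E]
    [InnerProductSpace ℝ E] [FiniteDimensional ℝ E] {F : E → E} (hF : ContDiff ℝ 1 F)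
    (hclose : ∀ x, ‖F x - x‖ < 1 / 2) : ∃ x, F x = 0 := by
  by_contra! hne
  -- `V` is `F` on the half ball and the identity on the unit sphere; beyond radius `1 / 2` the
  -- displacement is too small to cancel `x`.
  let χ : ContDiffBump (0 : E) := ⟨1 / 2, 3 / 4, by norm_num, by norm_num⟩
  let V : E → E := fun x => x + χ x • (F x - x)
  have hV : ContDiff ℝ 1 V := contDiff_id.add (χ.contDiff.smul (hF.sub contDiff_id))
  have hV0 : ∀ x, V x ≠ 0 := by
    intro x hx
    rcases le_or_gt ‖x‖ (1 / 2) with h | h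
    · have : χ x = 1 := χ.one_of_mem_closedBall (mem_closedBall_zero_iff.2 h)
      exact hne x (by simpa [V, this] using hx)
    · have h1 : ‖x‖ = χ x * ‖F x - x‖ := by
        rw [eq_neg_of_add_eq_zero_left hx, norm_neg, norm_smul, Real.norm_of_nonneg χ.nonneg,
          ← eq_neg_of_add_eq_zero_left hx]
      nlinarith [χ.le_one (x := x), norm_nonneg (F x - x), hclose x]
  refine ContDiff.not_forall_norm_eq_one_and_fixes_sphere (r := fun x => ‖V x‖⁻¹ • V x)
    (((hV.norm ℝ hV0).inv fun x => norm_ne_zero_iff.2 (hV0 x)).smul hV)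
    (fun x => norm_smul_inv_norm (𝕜 := ℝ) (hV0 x)) fun x hx => ?_
  have : χ x = 0 := χ.zero_of_le_dist (by simp [hx, χ]; norm_num)
  simp [V, this, hx]

/-- A finite-dimensional space is not a continuous retract of a space of smaller dimension. -/
theorem not_leftInverse_of_continuous_of_finrank_lt {E F : Type*} [NormedAddCommGroup E]
    [InnerProductSpace ℝ E] [FiniteDimensional ℝ E] [NormedAddCommGroup F] [NormedSpace ℝ F]
    [FiniteDimensional ℝ F] (hdim : Module.finrank ℝ F < Module.finrank ℝ E)
    {f : E → F} {g : F → E} (hf : Continuous f) (hg : Continuous g) :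
    ¬ Function.LeftInverse g f := by
  intro hgf
  obtain ⟨G, hG, hGg, -⟩ := hg.exists_contDiff_approx 1 (ε := fun _ => 1 / 8)
    continuous_const fun _ => by norm_num
  obtain ⟨c, hc, hcG⟩ := (hG.dense_compl_range_of_finrank_lt_finrank hdim).exists_mem_open
    (Metric.isOpen_ball (x := (0 : E)) (ε := 1 / 8)) ⟨0, Metric.mem_ball_self (by norm_num)⟩
  have hU : Continuous fun x => G (f x) - c := (hG.continuous.comp hf).sub continuous_const
  have hU0 : ∀ x, 0 < ‖G (f x) - c‖ := fun x =>
    norm_pos_iff.2 <| sub_ne_zero.2 fun h => hc ⟨f x, h⟩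
  -- An error below `‖G (f x) - c‖` keeps `W` nonzero; the three errors of `1 / 8` sum to less than
  -- `1 / 2`.
  obtain ⟨W, hW, hWU, -⟩ := hU.exists_contDiff_approx 1
    (ε := fun x => min (1 / 8) ‖G (f x) - c‖) (continuous_const.min hU.norm)
    fun x => lt_min (by norm_num) (hU0 x)
  obtain ⟨x, hx⟩ := hW.exists_eq_zero_of_norm_sub_lt fun x => by
    have h1 := (hWU x).trans_le (min_le_left _ _)
    have h2 := hGg (f x)
    rw [hgf x] at h2
    rw [dist_eq_norm] at h1 h2
    have h3 : ‖c‖ < 1 / 8 := mem_ball_zero_iff.1 hcG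
    calc ‖W x - x‖ = ‖(W x - (G (f x) - c)) + (G (f x) - x) - c‖ := by congr 1; abel
      _ ≤ ‖W x - (G (f x) - c)‖ + ‖G (f x) - x‖ + ‖c‖ :=
        (norm_sub_le _ _).trans (by gcongr; exact norm_add_le _ _)
      _ < 1 / 2 := by linarith
  have h := (hWU x).trans_le (min_le_right _ _)
  rw [hx, dist_zero_left] at h
  exact h.false

theorem not_leftInverse_of_continuous_pi {m n : ℕ} (hmn : m < n)
    {f : (Fin n → ℝ) → (Fin m → ℝ)} {g : (Fin m → ℝ) → (Fin n → ℝ)}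
    (hf : Continuous f) (hg : Continuous g) : ¬ Function.LeftInverse g f := by
  intro h
  let e := EuclideanSpace.equiv (Fin n) ℝ
  exact not_leftInverse_of_continuous_of_finrank_lt (E := EuclideanSpace ℝ (Fin n))
    (F := Fin m → ℝ) (by simpa using hmn) (hf.comp e.continuous) (e.symm.continuous.comp hg)
    fun x => by simp [h (e x)]

/-- A continuous self-map of `ℝⁿ` fixing an independent Gaussian vector almost surely is the
identity. -/
theorem eq_id_of_ae_gaussian_vector_eq {Ω : Type*} [MeasurableSpace Ω] {μ : Measure Ω}
    [IsProbabilityMeasure μ] {n : ℕ} {z : Fin n → Ω → ℝ}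
    (hz : ∀ i, HasLaw (z i) (gaussianReal 0 1) μ) (hind : iIndepFun z μ)
    {h : (Fin n → ℝ) → (Fin n → ℝ)} (hh : Continuous h)
    (hae : ∀ᵐ ω ∂μ, h (fun i => z i ω) = fun i => z i ω) : h = id := by
  have hm : ∀ i, AEMeasurable (z i) μ := fun i => (hz i).aemeasurable
  have hlaw := (iIndepFun_iff_map_fun_eq_pi_map hm).1 hind
  simp_rw [(hz _).map_eq] at hlaw
  have : (gaussianReal 0 1).IsOpenPosMeasure :=
    (gaussianReal_absolutelyContinuous' 0 one_ne_zero).isOpenPosMeasure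
  refine Continuous.ae_eq_iff_eq (Measure.pi fun _ : Fin n => gaussianReal 0 1) hh
    continuous_id |>.1 ?_
  rw [← hlaw]
  exact (ae_map_iff (aemeasurable_pi_lambda _ hm)
    (isClosed_eq hh continuous_id).measurableSet).2 hae

theorem theorem1 {Ω : Type*} [MeasurableSpace Ω] (μ : Measure Ω) [IsProbabilityMeasure μ]
    (H P : ℕ) (hHP : H ≠ P)
    (z : Fin H → Ω → ℝ) (y : Fin P → Ω → ℝ)
    (hz : ∀ i, HasLaw (z i) (gaussianReal 0 1) μ) (hz_indep : iIndepFun z μ)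
    (hy : ∀ j, HasLaw (y j) (gaussianReal 0 1) μ) (hy_indep : iIndepFun y μ) :
    ¬ ∃ (f : (Fin H → ℝ) → (Fin P → ℝ)) (g : (Fin P → ℝ) → (Fin H → ℝ)),
      Continuous f ∧ Continuous g ∧
      (∀ᵐ ω ∂μ, (fun i => z i ω) = g (fun j => y j ω)) ∧
      (∀ᵐ ω ∂μ, (fun j => y j ω) = f (fun i => z i ω)) := by
  rintro ⟨f, g, hf, hg, hzg, hyf⟩
  rcases hHP.lt_or_gt with hlt | hlt
  · refine not_leftInverse_of_continuous_pi hlt hg hf fun x => ?_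
    refine congrFun (eq_id_of_ae_gaussian_vector_eq hy hy_indep (hf.comp hg) ?_) x
    filter_upwards [hzg, hyf] with ω h1 h2
    rw [Function.comp_apply, ← h1, ← h2]
  · refine not_leftInverse_of_continuous_pi hlt hf hg fun x => ?_
    refine congrFun (eq_id_of_ae_gaussian_vector_eq hz hz_indep (hg.comp hf) ?_) x
    filter_upwards [hzg, hyf] with ω h1 h2
    rw [Function.comp_apply, ← h2, ← h1]
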